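/- **Theorem (generalized Hatano–Sasa inequality with quantum feedback).** Let $H$ be a finite-dimensional complex Hilbert space, identified with $\mathbb C^d$ by an orthonormal basis. A state is an operator $\rho\ge 0$ on $H$ with $\mathrm{tr}\,\rho=1$; its von Neumann entropy is $S(\rho)=-\mathrm{tr}[\rho\ln\rho]$ (with $0\ln 0=0$). For positive operators $\rho,\sigma$, the number $\mathrm{tr}[\rho\ln\sigma]\in[-\infty,\infty)$ is $-\infty$ if some $\psi\in H$ has $\sigma\psi=0$ and $\langle\psi,\rho\psi\rangle\neq0$, and otherwise it is computed on the support of $\sigma$. CPTP means completely positive and trace-preserving, for linear maps from operators on $H$ to operators on $H$. A CPTP map $\mathcal E$ has the unique steady state $\sigma$ if $\sigma$ is the only state with $\mathcal E(\sigma)=\sigma$. Let $0\le m\le N$ be integers and let $\rho_{\rm i}$ be a state. * *Before the measurement:* let $\mathcal E_1,\dots,\mathcal E_m$ be CPTP maps, where $\mathcal E_n$ has a unique steady state $\rho_{{\rm ss},n}$. Put $\rho_0=\rho_{\rm i}$ and $\rho_n=\mathcal E_n(\rho_{n-1})$ for $1\le n\le m$. * *Measurement:* let $B$ be a finite set and let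 $(M_b)_{b\in B}$ be operators on $H$ (Kraus operators) with $\sum_b M_b^\dagger M_b=I$. Put $p(b)=\mathrm{tr}[M_b^\dagger M_b\rho_m]$, $\rho_m^{(b)}=M_b\rho_mM_b^\dagger/p(b)$ (outcomes with $p(b)=0$ do not contribute to the sums below), and $$I_{\rm QC}=S(\rho_m)-\sum_b p(b)\,S(\rho_m^{(b)}).$$ * *Feedback:* for every $b\in B$ let $\mathcal E_{m+1}^{(b)},\dots,\mathcal E_N^{(b)}$ be CPTP maps, where $\mathcal E_n^{(b)}$ has a unique steady state $\rho_{{\rm ss},n}^{(b)}$. Put $\rho_n^{(b)}=\mathcal E_n^{(b)}(\rho_{n-1}^{(b)})$ for $m+1\le n\le N$. Define $$\sigma_{\rm ex}^B=\sum_{n=1}^m\bigl(\mathrm{tr}[\rho_n\ln\rho_{{\rm ss},n}]-\mathrm{tr}[\rho_{n-1}\ln\rho_{{\rm ss},n}]\bigr)+\sum_b p(b)\sum_{n=m+1}^N\bigl(\mathrm{tr}[\rho_n^{(b)}\ln\rho_{{\rm ss},n}^{(b)}]-\mathrm{tr}[\rho_{n-1}^{(b)}\ln\rho_{{\rm ss},n}^{(b)}]\bigr),$$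 and assume that this expression is defined, that is, none of the differences of two traces (for the second sum: those with $p(b)>0$) has the form $(-\infty)-(-\infty)$. This is automatic, and $\sigma_{\rm ex}^B$ is finite, if all the steady states are positive definite. Then $$\sum_b p(b)\,S(\rho_N^{(b)})-S(\rho_{\rm i})\ \ge\ -\sigma_{\rm ex}^B-I_{\rm QC},$$ an inequality in $[-\infty,\infty]$, with the convention $0\cdot\infty=0$ for $p(b)=0$. -/

import Mathlib

open scoped Matrix ComplexOrder

noncomputable section

namespace QFeedback

/-- Operators on the finite-dimensional Hilbert space `ℂ^d`, as matrices in an orthonormal basis. -/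
abbrev Op (d : Type*) : Type _ := Matrix d d ℂ

/-- Linear maps from operators to operators. -/
abbrev SuperOp (d : Type*) : Type _ := Op d →ₗ[ℂ] Op d

/-- Density operators: positive (semidefinite) with unit trace. -/
def IsDensity {d : Type*} [Fintype d] (ρ : Op d) : Prop :=
  ρ.PosSemidef ∧ ρ.trace = 1

/-- The map `E ⊗ id` on operators on `ℂ^d ⊗ ℂ^n`: it applies `E` to each of the `n × n` blocks
`X_{kl}` of `X = ∑ X_{kl} ⊗ |k⟩⟨l|`. -/
def ampliate {d : Type*} (E : SuperOp d) (n : ℕ) (X : Op (d × Fin n)) : Op (d × Fin n) :=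
  Matrix.of fun i j => E (Matrix.of fun a b => X (a, i.2) (b, j.2)) i.1 j.1

/-- Complete positivity: `E ⊗ id_n` maps positive operators to positive operators, for all `n`. -/
def IsCompletelyPositive {d : Type*} (E : SuperOp d) : Prop :=
  ∀ (n : ℕ) (X : Op (d × Fin n)), X.PosSemidef → (ampliate E n X).PosSemidef

def IsTracePreserving {d : Type*} [Fintype d] (E : SuperOp d) : Prop :=
  ∀ X : Op d, (E X).trace = X.trace

/-- Completely positive and trace-preserving. -/
def IsCPTP {d : Type*} [Fintype d] (E : SuperOp d) : Prop :=
  IsCompletelyPositive E ∧ IsTracePreserving E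

/-- `σ` is the one and only density operator fixed by `E`. -/
def IsUniqueSteadyState {d : Type*} [Fintype d] (E : SuperOp d) (σ : Op d) : Prop :=
  (IsDensity σ ∧ E σ = σ) ∧ ∀ τ : Op d, IsDensity τ → E τ = τ → τ = σ

/-- The von Neumann entropy `S(ρ) = -tr[ρ ln ρ]`. The logarithm is applied to the eigenvalues;
since `Real.log 0 = 0`, the convention `0 ln 0 = 0` holds. -/
def vonNeumannEntropy {d : Type*} [Fintype d] [DecidableEq d] (ρ : Op d) : ℝ :=
  -((ρ * cfc Real.log ρ).trace).re

open Classical in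
/-- `tr[ρ ln σ]` for positive `ρ` and `σ`, with its usual value in `[-∞, ∞)`: it is `-∞` exactly
when some vector `ψ` has `σ ψ = 0` and `⟨ψ, ρ ψ⟩ ≠ 0`. Otherwise `ρ` vanishes on the kernel of `σ`,
so that the zero eigenvalues of `σ` do not contribute. -/
def traceLog {d : Type*} [Fintype d] [DecidableEq d] (ρ σ : Op d) : EReal :=
  if ∃ ψ : d → ℂ, σ *ᵥ ψ = 0 ∧ star ψ ⬝ᵥ (ρ *ᵥ ψ) ≠ 0 then ⊥
  else (((ρ * cfc Real.log σ).trace.re : ℝ) : EReal)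

/-- The states `ρ_n` with `ρ_k = ρ` and `ρ_n = E_n (ρ_{n-1})` for `n > k`
(for `n < k` the value is `ρ` and is never used). -/
def trajectory {d : Type*} (E : ℕ → SuperOp d) (k : ℕ) (ρ : Op d) : ℕ → Op d
  | 0 => ρ
  | n + 1 => if n + 1 ≤ k then ρ else E (n + 1) (trajectory E k ρ n)

/-- The excess term
`σ_ex(k+1 → l) = ∑_{n=k+1}^{l} (tr[ρ_n ln ρ_{ss,n}] - tr[ρ_{n-1} ln ρ_{ss,n}])` along the
trajectory that starts from `ρ` at time `k`. -/
def excess {d : Type*} [Fintype d] [DecidableEq d] (E : ℕ → SuperOp d) (ss : ℕ → Op d)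
    (k l : ℕ) (ρ : Op d) : EReal :=
  ∑ n ∈ Finset.Ico k l,
    (traceLog (trajectory E k ρ (n + 1)) (ss (n + 1))
      - traceLog (trajectory E k ρ n) (ss (n + 1)))

/-- No summand of `excess E ss k l ρ` has the undefined form `(-∞) - (-∞)`. -/
def ExcessDefined {d : Type*} [Fintype d] [DecidableEq d] (E : ℕ → SuperOp d) (ss : ℕ → Op d)
    (k l : ℕ) (ρ : Op d) : Prop :=
  ∀ n ∈ Finset.Ico k l,
    ¬ (traceLog (trajectory E k ρ (n + 1)) (ss (n + 1)) = ⊥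
      ∧ traceLog (trajectory E k ρ n) (ss (n + 1)) = ⊥)

/-- The probability `p(b) = tr[M_b† M_b ρ]` of outcome `b`. -/
def outcomeProb {d B : Type*} [Fintype d] (M : B → Op d) (ρ : Op d) (b : B) : ℝ :=
  (((M b)ᴴ * M b * ρ).trace).re

/-- The post-measurement state `M_b ρ M_b† / p(b)`; for `p(b) = 0` it is zero, and it then only
enters with weight `p(b)`. -/
def postState {d B : Type*} [Fintype d] (M : B → Op d) (ρ : Op d) (b : B) : Op d :=
  ((outcomeProb M ρ b)⁻¹ : ℝ) • (M b * ρ * (M b)ᴴ)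

/-- The QC-mutual information (Groenewold–Ozawa information)
`I_QC = S(ρ) - ∑_b p(b) S(ρ(b))` of a measurement with Kraus operators `M_b` on `ρ`. -/
def qcMutualInfo {d B : Type*} [Fintype d] [DecidableEq d] [Fintype B]
    (M : B → Op d) (ρ : Op d) : ℝ :=
  vonNeumannEntropy ρ - ∑ b, outcomeProb M ρ b * vonNeumannEntropy (postState M ρ b)

/-- The total excess term
`σ_ex = σ_ex(1 → m) + ∑_b p(b) σ_ex(m+1 → N; b)`: evolution by `E_1, …, E_m`, then the measurement,
then evolution by `F_{m+1}^{(b)}, …, F_N^{(b)}` depending on the outcome `b`. -/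
def totalExcess {d B : Type*} [Fintype d] [DecidableEq d] [Fintype B] (m N : ℕ) (ρi : Op d)
    (E : ℕ → SuperOp d) (ss : ℕ → Op d) (M : B → Op d)
    (F : B → ℕ → SuperOp d) (ssF : B → ℕ → Op d) : EReal :=
  excess E ss 0 m ρi +
    ∑ b, ((outcomeProb M (trajectory E 0 ρi m) b : ℝ) : EReal) *
      excess (F b) (ssF b) m N (postState M (trajectory E 0 ρi m) b)

end QFeedback

end

/-!
The inequality is the telescoped data-processing inequality for the relative entropy. For a CPTP map
`E` with `E σ = σ`, monotonicity of the relative entropy between `ρ` and `σ` reads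
`S(ρ) - S(E ρ) ≤ tr[E(ρ) ln σ] - tr[ρ ln σ]` (`entropy_sub_le_traceLog_sub`). Summed along a
trajectory it bounds the entropy decrease by the excess term (`entropy_sub_le_excess`). Adding the
trajectory before the measurement and the `p(b)`-weighted trajectories after it leaves
`S(ρ_m) - ∑ p(b) S(ρ_m^(b))`, which is the information gain.

Data processing (`trace_log_data_processing`) follows from a scalar function. Let `p_j`, `q_i` be the
eigenvalues of `ρ` and `σ` and put `h(t) = ∑ |⟨i|j⟩|² p_j ln (q_i + t p_j)` (`logForm`). Then
`h(0) = tr[ρ ln σ]`, and `h(t) - (tr ρ) ln t` tends to `tr[ρ ln ρ]` as `t → ∞`. The derivative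
`h'(t) = ⟨ρ, (L_σ + t R_ρ)⁻¹ ρ⟩` (`resolventForm`) is the maximum over operators `X` of
`2 Re tr[X† ρ] - tr[X† σ X] - t tr[X ρ X†]`, and therefore decreases under CPTP maps: for a
maximizer `Y` at the images, `X = E†(Y)` does at least as well at `ρ`, `σ` by the Kadison-Schwarz
inequality (`trace_adjoint_schwarz`). Hence the difference of the functions `h` for `(ρ, σ)` and for
`(E ρ, E σ)` is monotone on `[0, ∞)`, and comparing its value at `0` with its limit at infinity gives
data processing.

No invertibility is used. The support of `ρ` lies in that of `σ` exactly when `h'` stays bounded as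
`t → 0`, so the same monotonicity shows that `E` preserves this inclusion (`kernelLE_map`). Thus no
summand of the excess term is `-∞`, and a summand `+∞` is harmless.
-/

namespace QFeedback

/-! ### Completely positive maps and the Kadison-Schwarz inequality -/

section CompletelyPositive

variable {d : Type*} [Fintype d]

/-- Ampliation of `S * A * Sᴴ`, where `S` is the block column with blocks `G k`: it applies `E` to
the blocks `G k * A * (G l)ᴴ`. -/
theorem ampliate_stack (E : SuperOp d) {n : ℕ} (A : Op d) (G : Fin n → Op d) (i j : d × Fin n) :
    ampliate E n ((Matrix.of fun (i : d × Fin n) c => G i.2 i.1 c) * A *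
      (Matrix.of fun (i : d × Fin n) c => G i.2 i.1 c)ᴴ) i j =
      E (G i.2 * A * (G j.2)ᴴ) i.1 j.1 := by
  simp only [ampliate, Matrix.of_apply]
  congr 2

theorem posSemidef_ampliate_stack {E : SuperOp d} (hE : IsCompletelyPositive E) {n : ℕ}
    {A : Op d} (hA : A.PosSemidef) (G : Fin n → Op d) :
    (Matrix.of fun i j : d × Fin n => E (G i.2 * A * (G j.2)ᴴ) i.1 j.1).PosSemidef := by
  have h := hE n _ (hA.mul_mul_conjTranspose_same
    (Matrix.of fun (i : d × Fin n) c => G i.2 i.1 c))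
  convert h using 1
  ext i j
  rw [ampliate_stack]
  rfl

/-- Complete positivity as a positive quadratic form: the operator matrix
`E (G k * A * (G l)ᴴ)` is positive, tested against the column of operators `H`. -/
theorem sum_trace_nonneg {E : SuperOp d} (hE : IsCompletelyPositive E) {n : ℕ}
    {A : Op d} (hA : A.PosSemidef) (G H : Fin n → Op d) :
    0 ≤ ∑ k, ∑ l, ((H k)ᴴ * E (G k * A * (G l)ᴴ) * H l).trace := by
  have h := ((posSemidef_ampliate_stack hE hA G).conjTranspose_mul_mul_same
    (Matrix.of fun (i : d × Fin n) c => H i.2 i.1 c)).trace_nonneg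
  convert h using 1
  simp only [Matrix.trace, Matrix.diag_apply, Matrix.mul_apply, Matrix.conjTranspose_apply,
    Matrix.of_apply, Fintype.sum_prod_type, Finset.sum_mul]
  simp only [Finset.sum_comm (s := (Finset.univ : Finset (Fin n))) (t := (Finset.univ : Finset d))]
  refine Finset.sum_congr rfl fun c _ => Finset.sum_congr rfl fun a _ => ?_
  rw [Finset.sum_comm]
  simp only [Finset.sum_comm (s := (Finset.univ : Finset (Fin n))) (t := (Finset.univ : Finset d))]
  refine Finset.sum_congr rfl fun b _ => ?_
  rw [Finset.sum_comm]

/-- A completely positive map preserves adjoints, because `[[A A†, A], [A†, 1]]` is positive, so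
that its image is Hermitian. -/
theorem map_conjTranspose [DecidableEq d] {E : SuperOp d}
    (hE : IsCompletelyPositive E) (A : Op d) : E Aᴴ = (E A)ᴴ := by
  have h := (posSemidef_ampliate_stack hE (Matrix.PosSemidef.one (n := d)) ![A, 1]).isHermitian
  ext i j
  have := h.apply (i, 1) (j, 0)
  simpa using this.symm

theorem map_posSemidef [DecidableEq d] {E : SuperOp d}
    (hE : IsCompletelyPositive E) {A : Op d} (hA : A.PosSemidef) : (E A).PosSemidef := by
  have h := (posSemidef_ampliate_stack hE hA (n := 1) fun _ => 1).submatrix fun i => (i, 0)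
  convert h using 1
  ext i j
  simp

theorem isDensity_map [DecidableEq d] {E : SuperOp d} (hE : IsCPTP E) {A : Op d}
    (hA : IsDensity A) : IsDensity (E A) :=
  ⟨map_posSemidef hE.1 hA.1, (hE.2 A).trans hA.2⟩

/-- Every map on operators has an adjoint for the Hilbert-Schmidt inner product. -/
theorem exists_trace_adjoint [DecidableEq d] (E : SuperOp d) (Y : Op d) :
    ∃ X : Op d, ∀ A, (Xᴴ * A).trace = (Yᴴ * E A).trace := by
  refine ⟨(Matrix.of fun b a => (Yᴴ * E (Matrix.single a b 1)).trace)ᴴ, fun A => ?_⟩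
  have hA : A = ∑ a, ∑ b, A a b • Matrix.single a b (1 : ℂ) := by
    conv_lhs => rw [Matrix.matrix_eq_sum_single A]
    simp
  have htr : ∀ P : Op d, (P * A).trace = ∑ b, ∑ a, P b a * A a b := fun P => by
    simp [Matrix.trace, Matrix.mul_apply]
  conv_rhs => rw [hA]
  rw [Matrix.conjTranspose_conjTranspose, htr]
  simp only [map_sum, map_smul, Matrix.mul_sum, Matrix.mul_smul,
    Matrix.trace_sum, Matrix.trace_smul, smul_eq_mul, Matrix.of_apply]
  rw [Finset.sum_comm]
  exact Finset.sum_congr rfl fun _ _ => Finset.sum_congr rfl fun _ _ => mul_comm _ _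

/-- The Kadison-Schwarz inequality for the adjoint `X = E†(Y)` of a CPTP map, in the weak form
`tr[X† A X] ≤ tr[Y† E(A) Y]`. -/
theorem trace_adjoint_schwarz [DecidableEq d] {E : SuperOp d} (hE : IsCPTP E) {A : Op d}
    (hA : A.PosSemidef) {X Y : Op d} (hXY : ∀ A, (Xᴴ * A).trace = (Yᴴ * E A).trace) :
    ((Xᴴ * A * X).trace).re ≤ ((Yᴴ * E A * Y).trace).re := by
  -- The positive block matrix `[[A, -A X], [-X† A, X† A X]]`, tested against `(Y, 1)`.
  have h := sum_trace_nonneg hE.1 hA ![1, -Xᴴ] ![Y, 1]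
  have h2 : (Yᴴ * E (A * X)).trace = (Xᴴ * A * X).trace := by
    rw [← hXY, Matrix.mul_assoc]
  have h1 : (E (Xᴴ * A) * Y).trace = star ((Xᴴ * A * X).trace) := by
    rw [← h2, ← Matrix.trace_conjTranspose, Matrix.conjTranspose_mul,
      ← map_conjTranspose hE.1, Matrix.conjTranspose_mul, hA.1.eq,
      Matrix.conjTranspose_conjTranspose]
  have h3 := hE.2 (Xᴴ * A * X)
  simp [Fin.sum_univ_two, h1, h2, h3] at h
  have h4 := (Complex.le_def.1 h).1
  simpa using h4

/-- The adjoint of a completely positive map preserves adjoints: `X = E†(Y)` implies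
`X† = E†(Y†)`. -/
theorem trace_adjoint_conjTranspose [DecidableEq d] {E : SuperOp d}
    (hE : IsCompletelyPositive E) {X Y : Op d}
    (hXY : ∀ A, (Xᴴ * A).trace = (Yᴴ * E A).trace) (A : Op d) :
    (Xᴴᴴ * A).trace = (Yᴴᴴ * E A).trace := by
  have h := congrArg star (hXY Aᴴ)
  rw [← Matrix.trace_conjTranspose, ← Matrix.trace_conjTranspose, map_conjTranspose hE,
    Matrix.conjTranspose_mul, Matrix.conjTranspose_mul] at h
  rw [Matrix.trace_mul_comm, Matrix.trace_mul_comm _ (E A)]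
  simpa only [Matrix.conjTranspose_conjTranspose] using h

/-- The quadratic form `2 Re tr[X† ρ] - tr[X† σ X] - t tr[X ρ X†]` in `X`. Its maximum over `X`
is `⟨ρ, (L_σ + t R_ρ)⁻¹ ρ⟩`, with `L_σ` and `R_ρ` the left and right multiplications. -/
noncomputable def variationalForm (ρ σ : Op d) (t : ℝ) (X : Op d) : ℝ :=
  2 * ((Xᴴ * ρ).trace).re - ((Xᴴ * σ * X).trace).re - t * ((X * ρ * Xᴴ).trace).re

/-- Every value of the variational form at the images is dominated by a value at the original
operators. The witness is the adjoint map applied to `Y`. -/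
theorem exists_variationalForm_le [DecidableEq d] {E : SuperOp d} (hE : IsCPTP E) {ρ σ : Op d}
    (hρ : ρ.PosSemidef) (hσ : σ.PosSemidef) {t : ℝ} (ht : 0 ≤ t) (Y : Op d) :
    ∃ X, variationalForm (E ρ) (E σ) t Y ≤ variationalForm ρ σ t X := by
  obtain ⟨X, hX⟩ := exists_trace_adjoint E Y
  refine ⟨X, ?_⟩
  have h1 := trace_adjoint_schwarz hE hσ hX
  have h2 := trace_adjoint_schwarz hE hρ (trace_adjoint_conjTranspose hE.1 hX)
  simp only [Matrix.conjTranspose_conjTranspose] at h2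
  have h3 := mul_le_mul_of_nonneg_left h2 ht
  unfold variationalForm
  rw [hX]
  linarith

end CompletelyPositive

/-! ### Spectral formulas and the resolvent forms -/

section Spectral

variable {d : Type*} [Fintype d] [DecidableEq d]

theorem cfc_eq_conj {A : Op d} (hA : A.IsHermitian) (f : ℝ → ℝ) :
    cfc f A = hA.eigenvectorUnitary.1 * Matrix.diagonal (fun i => (f (hA.eigenvalues i) : ℂ)) *
      hA.eigenvectorUnitary.1ᴴ := by
  rw [hA.cfc_eq, Matrix.IsHermitian.cfc, Unitary.conjStarAlgAut_apply]
  rfl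

theorem eq_conj {A : Op d} (hA : A.IsHermitian) :
    A = hA.eigenvectorUnitary.1 * Matrix.diagonal (fun i => (hA.eigenvalues i : ℂ)) *
      hA.eigenvectorUnitary.1ᴴ := by
  conv_lhs => rw [hA.spectral_theorem, Unitary.conjStarAlgAut_apply]
  rfl

/-- The matrix `⟨i|j⟩` between the eigenbases of `σ` (rows) and `ρ` (columns). -/
noncomputable def overlap {ρ σ : Op d} (hρ : ρ.IsHermitian) (hσ : σ.IsHermitian) : Op d :=
  hσ.eigenvectorUnitary.1ᴴ * hρ.eigenvectorUnitary.1

theorem eigenvectorUnitary_conj_mul {A : Op d} (hA : A.IsHermitian) :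
    hA.eigenvectorUnitary.1ᴴ * hA.eigenvectorUnitary.1 = 1 :=
  Unitary.coe_star_mul_self hA.eigenvectorUnitary

theorem eigenvectorUnitary_mul_conj {A : Op d} (hA : A.IsHermitian) :
    hA.eigenvectorUnitary.1 * hA.eigenvectorUnitary.1ᴴ = 1 :=
  Unitary.coe_mul_star_self hA.eigenvectorUnitary

theorem eigenvectorUnitary_conj_mul_cancel {A : Op d} (hA : A.IsHermitian) (B : Op d) :
    hA.eigenvectorUnitary.1ᴴ * (hA.eigenvectorUnitary.1 * B) = B := by
  rw [← Matrix.mul_assoc, eigenvectorUnitary_conj_mul, Matrix.one_mul]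

theorem eigenvectorUnitary_mul_conj_cancel {A : Op d} (hA : A.IsHermitian) (B : Op d) :
    hA.eigenvectorUnitary.1 * (hA.eigenvectorUnitary.1ᴴ * B) = B := by
  rw [← Matrix.mul_assoc, eigenvectorUnitary_mul_conj, Matrix.one_mul]

theorem overlap_conj_mul {ρ σ : Op d} (hρ : ρ.IsHermitian) (hσ : σ.IsHermitian) :
    (overlap hρ hσ)ᴴ * overlap hρ hσ = 1 := by
  simp only [overlap, Matrix.conjTranspose_mul, Matrix.conjTranspose_conjTranspose,
    Matrix.mul_assoc, eigenvectorUnitary_mul_conj_cancel, eigenvectorUnitary_conj_mul]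

/-- The transition probabilities `|⟨i|j⟩|²`. -/
noncomputable def overlapSq {ρ σ : Op d} (hρ : ρ.IsHermitian) (hσ : σ.IsHermitian) (i j : d) : ℝ :=
  Complex.normSq (overlap hρ hσ i j)

theorem overlapSq_nonneg {ρ σ : Op d} (hρ : ρ.IsHermitian) (hσ : σ.IsHermitian) (i j : d) :
    0 ≤ overlapSq hρ hσ i j := Complex.normSq_nonneg _

theorem sum_overlapSq {ρ σ : Op d} (hρ : ρ.IsHermitian) (hσ : σ.IsHermitian) (j : d) :
    ∑ i, overlapSq hρ hσ i j = 1 := by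
  have h := congrFun (congrFun (overlap_conj_mul hρ hσ) j) j
  simp only [Matrix.mul_apply, Matrix.conjTranspose_apply, Matrix.one_apply_eq] at h
  have h' := congrArg Complex.re h
  simpa [overlapSq, Complex.normSq_apply] using h'

theorem re_trace_diagonal (x : Op d) (a b : d → ℝ) :
    ((xᴴ * Matrix.diagonal (fun i => (a i : ℂ)) * x * Matrix.diagonal (fun i => (b i : ℂ))).trace).re
      = ∑ i, ∑ j, Complex.normSq (x i j) * a i * b j := by
  rw [Finset.sum_comm]
  simp only [Matrix.trace, Matrix.diag_apply, Matrix.mul_diagonal, Matrix.mul_apply (N := x),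
    Matrix.conjTranspose_apply, Complex.re_sum, Finset.sum_mul]
  refine Finset.sum_congr rfl fun j _ => Finset.sum_congr rfl fun i _ => ?_
  simp only [Complex.star_def, Complex.mul_re, Complex.mul_im, Complex.ofReal_re,
    Complex.ofReal_im, Complex.conj_re, Complex.conj_im, Complex.normSq_apply]
  ring

theorem re_trace_mul_cfc {ρ σ : Op d} (hρ : ρ.IsHermitian) (hσ : σ.IsHermitian) (f : ℝ → ℝ) :
    ((ρ * cfc f σ).trace).re =
      ∑ i, ∑ j, overlapSq hρ hσ i j * f (hσ.eigenvalues i) * hρ.eigenvalues j := by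
  have hρ' := eq_conj hρ
  simp only [overlapSq]
  rw [← re_trace_diagonal (overlap hρ hσ) (fun i => f (hσ.eigenvalues i)), cfc_eq_conj hσ, overlap]
  generalize hρ.eigenvectorUnitary.1 = U at *
  generalize hρ.eigenvalues = p at *
  rw [hρ']
  simp only [Matrix.conjTranspose_mul, Matrix.conjTranspose_conjTranspose, Matrix.mul_assoc]
  rw [Matrix.trace_mul_comm, Matrix.mul_assoc, Matrix.trace_mul_comm]
  simp only [Matrix.mul_assoc]

/-- `tr[ρ f(ρ)]` as a double sum over both eigenbases, for comparison with `tr[ρ f(σ)]`. -/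
theorem re_trace_mul_cfc_self {ρ σ : Op d} (hρ : ρ.IsHermitian) (hσ : σ.IsHermitian) (f : ℝ → ℝ) :
    ((ρ * cfc f ρ).trace).re =
      ∑ i, ∑ j, overlapSq hρ hσ i j * f (hρ.eigenvalues j) * hρ.eigenvalues j := by
  rw [re_trace_mul_cfc hρ hρ, Finset.sum_comm]
  conv_rhs => rw [Finset.sum_comm]
  simp only [mul_assoc, ← Finset.sum_mul, sum_overlapSq]
  have h : overlap hρ hρ = 1 := eigenvectorUnitary_conj_mul hρ
  simp [overlapSq, h, Matrix.one_apply, apply_ite Complex.normSq]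

theorem re_trace_eq_sum {ρ σ : Op d} (hρ : ρ.IsHermitian) (hσ : σ.IsHermitian) :
    (ρ.trace).re = ∑ i, ∑ j, overlapSq hρ hσ i j * hρ.eigenvalues j := by
  have h := re_trace_mul_cfc hρ hσ fun _ => 1
  have h1 : cfc (fun _ : ℝ => (1 : ℝ)) σ = 1 := cfc_const_one ℝ σ hσ
  rw [h1] at h
  simpa using h

/-- `⟨ρ, (L_σ + t R_ρ)⁻¹ ρ⟩` in terms of the spectral data of `ρ` and `σ`. For `t > 0` a vanishing
denominator occurs only together with a vanishing numerator, so that `0 / 0 = 0` is the right value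
of the term. At `t = 0` this needs `KernelLE ρ σ`. -/
noncomputable def resolventForm {ρ σ : Op d} (hρ : ρ.IsHermitian) (hσ : σ.IsHermitian) (t : ℝ) : ℝ :=
  ∑ i, ∑ j, overlapSq hρ hσ i j *
    (hρ.eigenvalues j ^ 2 / (hσ.eigenvalues i + t * hρ.eigenvalues j))

theorem variationalForm_conj {ρ σ : Op d} (hρ : ρ.IsHermitian) (hσ : σ.IsHermitian) (t : ℝ)
    (x : Op d) :
    variationalForm ρ σ t (hσ.eigenvectorUnitary.1 * x * hρ.eigenvectorUnitary.1ᴴ) =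
      ∑ i, ∑ j, (2 * (star (x i j) * overlap hρ hσ i j).re * hρ.eigenvalues j -
        (hσ.eigenvalues i + t * hρ.eigenvalues j) * Complex.normSq (x i j)) := by
  have hρ' := eq_conj hρ
  have hσ' := eq_conj hσ
  have hU := eigenvectorUnitary_conj_mul hρ
  have hV := eigenvectorUnitary_conj_mul hσ
  have hU' := eigenvectorUnitary_conj_mul_cancel hρ
  have hV' := eigenvectorUnitary_conj_mul_cancel hσ
  unfold overlap
  generalize hρ.eigenvectorUnitary.1 = U at *
  generalize hρ.eigenvalues = p at *
  generalize hσ.eigenvectorUnitary.1 = V at *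
  generalize hσ.eigenvalues = q at *
  have h1 : (((V * x * Uᴴ)ᴴ * ρ).trace).re =
      ∑ i, ∑ j, (star (x i j) * (Vᴴ * U) i j).re * p j := by
    have : ((V * x * Uᴴ)ᴴ * ρ).trace =
        (xᴴ * (Vᴴ * U) * Matrix.diagonal (fun i => (p i : ℂ))).trace := by
      rw [hρ']
      simp only [Matrix.conjTranspose_mul, Matrix.conjTranspose_conjTranspose, Matrix.mul_assoc]
      rw [Matrix.trace_mul_comm]
      simp only [Matrix.mul_assoc, hU, Matrix.mul_one]
    rw [this, Finset.sum_comm]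
    simp only [Matrix.trace, Matrix.diag_apply, Matrix.mul_diagonal, Matrix.mul_apply (M := xᴴ),
      Matrix.conjTranspose_apply, Complex.re_sum, Finset.sum_mul, Complex.re_mul_ofReal]
  have h2 : (((V * x * Uᴴ)ᴴ * σ * (V * x * Uᴴ)).trace).re =
      ∑ i, ∑ j, Complex.normSq (x i j) * q i * (fun _ => 1 : d → ℝ) j := by
    rw [← re_trace_diagonal, hσ']
    simp only [Matrix.conjTranspose_mul, Matrix.conjTranspose_conjTranspose, Matrix.mul_assoc, hV']
    rw [Matrix.trace_mul_comm]
    simp [Matrix.mul_assoc, hU]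
  have h3 : ((V * x * Uᴴ * ρ * (V * x * Uᴴ)ᴴ).trace).re =
      ∑ i, ∑ j, Complex.normSq (x i j) * (fun _ => 1 : d → ℝ) i * p j := by
    rw [← re_trace_diagonal, hρ']
    simp only [Matrix.conjTranspose_mul, Matrix.conjTranspose_conjTranspose, Matrix.mul_assoc, hU']
    rw [Matrix.trace_mul_comm, Matrix.trace_mul_comm xᴴ]
    simp [Matrix.mul_assoc, hV]
  unfold variationalForm
  rw [h1, h2, h3]
  simp only [Finset.mul_sum, ← Finset.sum_sub_distrib]
  refine Finset.sum_congr rfl fun i _ => Finset.sum_congr rfl fun j _ => ?_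
  ring

/-- Completing the square: `s |x - (p / s) u|² ≥ 0`. -/
theorem two_mul_re_sub_le (x u : ℂ) {p s : ℝ} (hs : 0 ≤ s) (hsp : s = 0 → p = 0) :
    2 * (star x * u).re * p - s * Complex.normSq x ≤ Complex.normSq u * (p ^ 2 / s) := by
  rcases hs.eq_or_lt with h | h
  · simp [← h, hsp h.symm]
  · rw [← mul_div_assoc, le_div_iff₀ h]
    simp only [Complex.star_def, Complex.mul_re, Complex.conj_re, Complex.conj_im,
      Complex.normSq_apply]
    nlinarith [sq_nonneg (s * x.re - p * u.re), sq_nonneg (s * x.im - p * u.im)]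

/-- Complete the square in each matrix entry of `X` with respect to the two eigenbases. -/
theorem variationalForm_le_resolventForm {ρ σ : Op d} (hρ : ρ.PosSemidef) (hσ : σ.PosSemidef)
    {t : ℝ} (ht : 0 < t) (X : Op d) :
    variationalForm ρ σ t X ≤ resolventForm hρ.1 hσ.1 t := by
  have hX : X = hσ.1.eigenvectorUnitary.1 *
      (hσ.1.eigenvectorUnitary.1ᴴ * X * hρ.1.eigenvectorUnitary.1) *
      hρ.1.eigenvectorUnitary.1ᴴ := by
    simp only [Matrix.mul_assoc, eigenvectorUnitary_mul_conj_cancel, eigenvectorUnitary_mul_conj,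
      Matrix.mul_one]
  rw [hX, variationalForm_conj]
  refine Finset.sum_le_sum fun i _ => Finset.sum_le_sum fun j _ => ?_
  have hq := hσ.eigenvalues_nonneg i
  have hp := hρ.eigenvalues_nonneg j
  refine two_mul_re_sub_le _ _ (by positivity) fun h => ?_
  have := mul_nonneg ht.le hp
  exact (mul_eq_zero.1 (by linarith : t * hρ.1.eigenvalues j = 0)).resolve_left ht.ne'

/-- The maximum of the variational form is attained at the operator with entries
`⟨i|j⟩ p_j / (q_i + t p_j)` in the two eigenbases. -/
theorem exists_variationalForm_eq {ρ σ : Op d} (hρ : ρ.PosSemidef) (hσ : σ.PosSemidef) (t : ℝ) :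
    ∃ X, variationalForm ρ σ t X = resolventForm hρ.1 hσ.1 t := by
  refine ⟨_, (variationalForm_conj hρ.1 hσ.1 t (Matrix.of fun i j => overlap hρ.1 hσ.1 i j *
    (hρ.1.eigenvalues j / (hσ.1.eigenvalues i + t * hρ.1.eigenvalues j) : ℝ))).trans ?_⟩
  refine Finset.sum_congr rfl fun i _ => Finset.sum_congr rfl fun j _ => ?_
  rw [overlapSq, Matrix.of_apply]
  generalize overlap hρ.1 hσ.1 i j = u
  generalize hσ.1.eigenvalues i + t * hρ.1.eigenvalues j = s
  generalize hρ.1.eigenvalues j = p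
  simp only [Complex.normSq_apply, Complex.star_def,
    Complex.mul_re, Complex.mul_im, Complex.conj_re, Complex.conj_im, Complex.ofReal_re,
    Complex.ofReal_im]
  rcases eq_or_ne s 0 with rfl | hs
  · simp
  · field_simp
    ring

/-- Monotonicity of the resolvent forms under CPTP maps. -/
theorem resolventForm_map_le {E : SuperOp d} (hE : IsCPTP E) {ρ σ : Op d} (hρ : ρ.PosSemidef)
    (hσ : σ.PosSemidef) {t : ℝ} (ht : 0 < t) :
    resolventForm (map_posSemidef hE.1 hρ).1 (map_posSemidef hE.1 hσ).1 t ≤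
      resolventForm hρ.1 hσ.1 t := by
  obtain ⟨Y, hY⟩ := exists_variationalForm_eq (map_posSemidef hE.1 hρ) (map_posSemidef hE.1 hσ) t
  obtain ⟨X, hX⟩ := exists_variationalForm_le hE hρ hσ ht.le Y
  exact hY ▸ hX.trans (variationalForm_le_resolventForm hρ hσ ht X)

/-- For positive `ρ` and `σ`: `ρ` vanishes on the kernel of `σ`, that is, the support of `ρ` lies in
that of `σ`. It is stated through the quadratic form of `ρ`, as in `traceLog`. -/
def KernelLE (ρ σ : Op d) : Prop := ∀ ψ : d → ℂ, σ *ᵥ ψ = 0 → star ψ ⬝ᵥ (ρ *ᵥ ψ) = 0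

theorem quadraticForm_eq_sum {A : Op d} (hA : A.IsHermitian) (ψ : d → ℂ) :
    star ψ ⬝ᵥ (A *ᵥ ψ) = ∑ j, (hA.eigenvalues j : ℂ) *
      Complex.normSq ((hA.eigenvectorUnitary.1ᴴ *ᵥ ψ) j) := by
  have hA' := eq_conj hA
  generalize hA.eigenvectorUnitary.1 = U at *
  generalize hA.eigenvalues = p at *
  rw [hA', ← Matrix.mulVec_mulVec, ← Matrix.mulVec_mulVec, Matrix.dotProduct_mulVec,
    ← Matrix.conjTranspose_conjTranspose U, ← Matrix.star_mulVec,
    Matrix.conjTranspose_conjTranspose, dotProduct]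
  refine Finset.sum_congr rfl fun j _ => ?_
  rw [Matrix.mulVec_diagonal, Complex.normSq_eq_conj_mul_self, Pi.star_apply, Complex.star_def]
  ring

/-- The support condition in spectral terms: no eigenvector of `ρ` with nonzero eigenvalue overlaps
an eigenvector of `σ` with eigenvalue zero. -/
theorem kernelLE_iff {ρ σ : Op d} (hρ : ρ.PosSemidef) (hσ : σ.PosSemidef) :
    KernelLE ρ σ ↔ ∀ i j, hσ.1.eigenvalues i = 0 →
      overlapSq hρ.1 hσ.1 i j * hρ.1.eigenvalues j = 0 := by
  have hq := hσ.eigenvalues_nonneg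
  have hp := hρ.eigenvalues_nonneg
  constructor
  · intro h i j hi
    have h0 : σ *ᵥ (hσ.1.eigenvectorUnitary.1 *ᵥ Pi.single i 1) = 0 := by
      rw [hσ.1.eigenvectorUnitary_mulVec, hσ.1.mulVec_eigenvectorBasis, hi, zero_smul]
    have h1 := h _ h0
    rw [quadraticForm_eq_sum hρ.1] at h1
    have h2 : ∑ j, hρ.1.eigenvalues j * overlapSq hρ.1 hσ.1 i j = 0 := by
      have : ∀ j, (hρ.1.eigenvectorUnitary.1ᴴ *ᵥ
          (hσ.1.eigenvectorUnitary.1 *ᵥ Pi.single i 1)) j = star (overlap hρ.1 hσ.1 i j) := by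
        intro j
        rw [Matrix.mulVec_mulVec, Matrix.mulVec_single_one, Matrix.col_apply,
          ← Matrix.conjTranspose_apply, overlap, Matrix.conjTranspose_mul,
          Matrix.conjTranspose_conjTranspose]
      simp only [this, Complex.star_def, Complex.normSq_conj] at h1
      exact_mod_cast h1
    rw [Finset.sum_eq_zero_iff_of_nonneg fun j _ => mul_nonneg (hp j) (overlapSq_nonneg _ _ _ _)]
      at h2
    rw [mul_comm]
    exact h2 j (Finset.mem_univ _)
  · intro h ψ hψ
    have h1 : ∀ i, hσ.1.eigenvalues i = 0 ∨ (hσ.1.eigenvectorUnitary.1ᴴ *ᵥ ψ) i = 0 := by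
      have h2 := quadraticForm_eq_sum hσ.1 ψ
      rw [hψ, dotProduct_zero] at h2
      have h3 : ∑ i, hσ.1.eigenvalues i *
          Complex.normSq ((hσ.1.eigenvectorUnitary.1ᴴ *ᵥ ψ) i) = 0 := by
        exact_mod_cast h2.symm
      rw [Finset.sum_eq_zero_iff_of_nonneg fun j _ => mul_nonneg (hq j) (Complex.normSq_nonneg _)]
        at h3
      intro i
      simpa using h3 i (Finset.mem_univ _)
    have h2 : hρ.1.eigenvectorUnitary.1ᴴ *ᵥ ψ =
        (overlap hρ.1 hσ.1)ᴴ *ᵥ (hσ.1.eigenvectorUnitary.1ᴴ *ᵥ ψ) := by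
      rw [Matrix.mulVec_mulVec, overlap, Matrix.conjTranspose_mul,
        Matrix.conjTranspose_conjTranspose, Matrix.mul_assoc, eigenvectorUnitary_mul_conj,
        Matrix.mul_one]
    rw [quadraticForm_eq_sum hρ.1]
    refine Finset.sum_eq_zero fun j _ => ?_
    rcases eq_or_ne (hρ.1.eigenvalues j) 0 with hj | hj
    · simp [hj]
    · have : (hρ.1.eigenvectorUnitary.1ᴴ *ᵥ ψ) j = 0 := by
        rw [h2]
        refine Finset.sum_eq_zero fun i _ => ?_
        rcases h1 i with hi | hi
        · have : overlap hρ.1 hσ.1 i j = 0 :=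
            Complex.normSq_eq_zero.1 ((mul_eq_zero.1 (h i j hi)).resolve_right hj)
          simp [this]
        · simp [hi]
      simp [this]

end Spectral

/-! ### The data-processing inequality -/

section DataProcessing

open Filter Topology

variable {d : Type*} [Fintype d] [DecidableEq d]

theorem resolventForm_le_of_kernelLE {ρ σ : Op d} (hρ : ρ.PosSemidef) (hσ : σ.PosSemidef)
    (h : KernelLE ρ σ) {t : ℝ} (ht : 0 < t) :
    resolventForm hρ.1 hσ.1 t ≤ resolventForm hρ.1 hσ.1 0 := by
  refine Finset.sum_le_sum fun i _ => Finset.sum_le_sum fun j _ => ?_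
  have hp := hρ.eigenvalues_nonneg j
  rcases (hσ.eigenvalues_nonneg i).eq_or_lt with hi | hi
  · rcases mul_eq_zero.1 ((kernelLE_iff hρ hσ).1 h i j hi.symm) with h0 | h0 <;> simp [h0]
  · refine mul_le_mul_of_nonneg_left ?_ (overlapSq_nonneg _ _ _ _)
    refine div_le_div_of_nonneg_left (sq_nonneg _) (by simpa using hi) ?_
    have := mul_nonneg ht.le hp
    linarith

/-- A term with `q_i = 0` equals `|⟨i|j⟩|² p_j / t`, so boundedness as `t → 0` makes it vanish. -/
theorem kernelLE_of_resolventForm_le {ρ σ : Op d} (hρ : ρ.PosSemidef) (hσ : σ.PosSemidef)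
    {C : ℝ} (h : ∀ t, 0 < t → resolventForm hρ.1 hσ.1 t ≤ C) : KernelLE ρ σ := by
  rw [kernelLE_iff hρ hσ]
  intro i j hi
  have hp := hρ.eigenvalues_nonneg
  have hq := hσ.eigenvalues_nonneg
  have hw := overlapSq_nonneg hρ.1 hσ.1
  have key : ∀ t, 0 < t → overlapSq hρ.1 hσ.1 i j * hρ.1.eigenvalues j ≤ C * t := by
    intro t ht
    have hnn : ∀ i j, 0 ≤ overlapSq hρ.1 hσ.1 i j *
        (hρ.1.eigenvalues j ^ 2 / (hσ.1.eigenvalues i + t * hρ.1.eigenvalues j)) := fun i j =>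
      mul_nonneg (hw i j) (div_nonneg (sq_nonneg _)
        (add_nonneg (hq i) (mul_nonneg ht.le (hp j))))
    have h1 := (Finset.single_le_sum (fun j _ => hnn i j) (Finset.mem_univ j)).trans
      (Finset.single_le_sum (fun i _ => Finset.sum_nonneg fun j _ => hnn i j)
        (Finset.mem_univ i)) |>.trans (h t ht)
    rw [← div_le_iff₀ ht]
    refine le_trans (le_of_eq ?_) h1
    rw [hi, zero_add]
    rcases eq_or_ne (hρ.1.eigenvalues j) 0 with h0 | h0
    · simp [h0]
    · field_simp
  have hlim : Tendsto (fun t : ℝ => C * t) (𝓝[>] 0) (𝓝 0) := by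
    have : Tendsto (fun t : ℝ => C * t) (𝓝 0) (𝓝 (C * 0)) := tendsto_id.const_mul C
    rw [mul_zero] at this
    exact this.mono_left nhdsWithin_le_nhds
  refine le_antisymm (ge_of_tendsto hlim ?_) (mul_nonneg (hw i j) (hp j))
  filter_upwards [self_mem_nhdsWithin] with t ht using key t ht

/-- CPTP maps preserve the inclusion of supports. -/
theorem kernelLE_map {E : SuperOp d} (hE : IsCPTP E) {ρ σ : Op d} (hρ : ρ.PosSemidef)
    (hσ : σ.PosSemidef) (h : KernelLE ρ σ) : KernelLE (E ρ) (E σ) :=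
  kernelLE_of_resolventForm_le (map_posSemidef hE.1 hρ) (map_posSemidef hE.1 hσ)
    fun _ ht => (resolventForm_map_le hE hρ hσ ht).trans (resolventForm_le_of_kernelLE hρ hσ h ht)

/-- The primitive in `t` of the resolvent form, `tr[ρ ln (L_σ + t R_ρ)]` evaluated in eigenbases.
It interpolates between `tr[ρ ln σ]` at `t = 0` and `tr[ρ ln ρ] + (tr ρ) ln t` as `t → ∞`. -/
noncomputable def logForm {ρ σ : Op d} (hρ : ρ.IsHermitian) (hσ : σ.IsHermitian) (t : ℝ) : ℝ :=
  ∑ i, ∑ j, overlapSq hρ hσ i j * hρ.eigenvalues j *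
    Real.log (hσ.eigenvalues i + t * hρ.eigenvalues j)

theorem logForm_zero {ρ σ : Op d} (hρ : ρ.IsHermitian) (hσ : σ.IsHermitian) :
    logForm hρ hσ 0 = ((ρ * cfc Real.log σ).trace).re := by
  rw [re_trace_mul_cfc hρ hσ]
  refine Finset.sum_congr rfl fun i _ => Finset.sum_congr rfl fun j _ => ?_
  rw [zero_mul, add_zero]
  ring

theorem hasDerivAt_logForm {ρ σ : Op d} (hρ : ρ.PosSemidef) (hσ : σ.PosSemidef) {t : ℝ}
    (ht : 0 < t) : HasDerivAt (logForm hρ.1 hσ.1) (resolventForm hρ.1 hσ.1 t) t := by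
  unfold logForm resolventForm
  refine HasDerivAt.fun_sum fun i _ => HasDerivAt.fun_sum fun j _ => ?_
  have hp := hρ.eigenvalues_nonneg j
  have hq := hσ.eigenvalues_nonneg i
  generalize hρ.1.eigenvalues j = p at *
  generalize hσ.1.eigenvalues i = q at *
  rcases hp.eq_or_lt with rfl | hp
  · simpa using hasDerivAt_const t (0 : ℝ)
  · have h1 : HasDerivAt (fun t => q + t * p) p t := by
      simpa using ((hasDerivAt_id t).mul_const p).const_add q
    have h2 := (h1.log (by positivity)).const_mul (overlapSq hρ.1 hσ.1 i j * p)
    exact h2.congr_deriv (by ring)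

/-- Continuity up to `t = 0` is where the inclusion of supports enters: it removes the terms
`ln (t p_j)`, for which `Real.log 0 = 0` would be a wrong limit. -/
theorem continuousOn_logForm {ρ σ : Op d} (hρ : ρ.PosSemidef) (hσ : σ.PosSemidef)
    (h : KernelLE ρ σ) : ContinuousOn (logForm hρ.1 hσ.1) (Set.Ici 0) := by
  unfold logForm
  refine continuousOn_finsetSum _ fun i _ => continuousOn_finsetSum _ fun j _ => ?_
  rcases (hσ.eigenvalues_nonneg i).eq_or_lt with hi | hi
  · simp only [(kernelLE_iff hρ hσ).1 h i j hi.symm, zero_mul]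
    exact continuousOn_const
  · refine continuousOn_const.mul (ContinuousOn.log (by fun_prop) fun t ht => ?_)
    have := mul_nonneg (Set.mem_Ici.1 ht) (hρ.eigenvalues_nonneg j)
    linarith

theorem tendsto_logForm_sub_log {ρ σ : Op d} (hρ : ρ.PosSemidef) (hσ : σ.PosSemidef) :
    Tendsto (fun t => logForm hρ.1 hσ.1 t - (ρ.trace).re * Real.log t) atTop
      (𝓝 ((ρ * cfc Real.log ρ).trace).re) := by
  rw [re_trace_mul_cfc_self hρ.1 hσ.1, re_trace_eq_sum hρ.1 hσ.1]
  simp only [logForm, Finset.sum_mul, ← Finset.sum_sub_distrib]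
  refine tendsto_finsetSum _ fun i _ => tendsto_finsetSum _ fun j _ => ?_
  have hp := hρ.eigenvalues_nonneg j
  have hq := hσ.eigenvalues_nonneg i
  generalize hρ.1.eigenvalues j = p at *
  generalize hσ.1.eigenvalues i = q at *
  rcases hp.eq_or_lt with rfl | hp
  · simp
  · have h1 : Tendsto (fun t : ℝ => q / t + p) atTop (𝓝 p) := by
      simpa using (tendsto_const_nhds.div_atTop tendsto_id).add_const p
    have h2 := ((Real.continuousAt_log hp.ne').tendsto.comp h1).const_mul
      (overlapSq hρ.1 hσ.1 i j * p)
    rw [mul_right_comm]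
    refine h2.congr' ?_
    filter_upwards [eventually_gt_atTop 0] with t ht
    have h3 : q / t + p = (q + t * p) / t := by field_simp
    rw [Function.comp_apply, h3, Real.log_div (by positivity) ht.ne']
    ring

/-- The data-processing inequality for the relative entropy: the increase of `tr[ρ ln σ]` under a
CPTP map is at least that of `tr[ρ ln ρ]`. -/
theorem trace_log_data_processing {E : SuperOp d} (hE : IsCPTP E) {ρ σ : Op d}
    (hρ : ρ.PosSemidef) (hσ : σ.PosSemidef) (h : KernelLE ρ σ) :
    vonNeumannEntropy ρ - vonNeumannEntropy (E ρ) ≤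
      ((E ρ * cfc Real.log (E σ)).trace).re - ((ρ * cfc Real.log σ).trace).re := by
  have hρ' := map_posSemidef hE.1 hρ
  have hσ' := map_posSemidef hE.1 hσ
  have hmono : MonotoneOn (fun t => logForm hρ.1 hσ.1 t - logForm hρ'.1 hσ'.1 t) (Set.Ici 0) := by
    have hder : ∀ t ∈ interior (Set.Ici (0 : ℝ)),
        HasDerivAt (fun t => logForm hρ.1 hσ.1 t - logForm hρ'.1 hσ'.1 t)
          (resolventForm hρ.1 hσ.1 t - resolventForm hρ'.1 hσ'.1 t) t := by
      intro t ht
      rw [interior_Ici] at ht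
      exact (hasDerivAt_logForm hρ hσ ht).sub (hasDerivAt_logForm hρ' hσ' ht)
    refine monotoneOn_of_deriv_nonneg (convex_Ici 0)
      ((continuousOn_logForm hρ hσ h).sub (continuousOn_logForm hρ' hσ' (kernelLE_map hE hρ hσ h)))
      (fun t ht => (hder t ht).differentiableAt.differentiableWithinAt) fun t ht => ?_
    rw [(hder t ht).deriv, sub_nonneg]
    rw [interior_Ici] at ht
    exact resolventForm_map_le hE hρ hσ ht
  -- The terms `(tr ρ) ln t` cancel because `E` preserves the trace.
  have hlim := (tendsto_logForm_sub_log hρ hσ).sub (tendsto_logForm_sub_log hρ' hσ')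
  rw [hE.2 ρ] at hlim
  simp only [sub_sub_sub_cancel_right] at hlim
  have hle := ge_of_tendsto hlim ((eventually_ge_atTop 0).mono fun t (ht : (0 : ℝ) ≤ t) =>
    hmono (Set.mem_Ici.2 le_rfl) (Set.mem_Ici.2 ht) ht)
  simp only [logForm_zero] at hle
  unfold vonNeumannEntropy
  linarith

end DataProcessing

/-! ### Trajectories, measurement and feedback -/

section HatanoSasa

theorem trajectory_succ {d : Type*} (E : ℕ → SuperOp d) {k n : ℕ} (h : k ≤ n) (ρ : Op d) :
    trajectory E k ρ (n + 1) = E (n + 1) (trajectory E k ρ n) := by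
  rw [trajectory, if_neg (by omega)]

theorem trajectory_self {d : Type*} (E : ℕ → SuperOp d) (k : ℕ) (ρ : Op d) :
    trajectory E k ρ k = ρ := by
  cases k <;> simp [trajectory]

theorem outcomeProb_eq {d B : Type*} [Fintype d] (M : B → Op d) (ρ : Op d) (b : B) :
    outcomeProb M ρ b = ((M b * ρ * (M b)ᴴ).trace).re := by
  rw [outcomeProb, Matrix.trace_mul_comm _ (M b)ᴴ, Matrix.mul_assoc]

theorem outcomeProb_nonneg {d B : Type*} [Fintype d] (M : B → Op d) {ρ : Op d}
    (hρ : ρ.PosSemidef) (b : B) : 0 ≤ outcomeProb M ρ b := by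
  rw [outcomeProb_eq]
  exact (Complex.le_def.1 (hρ.mul_mul_conjTranspose_same (M b)).trace_nonneg).1

theorem isDensity_postState {d B : Type*} [Fintype d] {M : B → Op d} {ρ : Op d}
    (hρ : ρ.PosSemidef) {b : B} (hb : outcomeProb M ρ b ≠ 0) : IsDensity (postState M ρ b) := by
  have hpos := hρ.mul_mul_conjTranspose_same (M b)
  refine ⟨hpos.smul (inv_nonneg.2 (outcomeProb_nonneg M hρ b)), ?_⟩
  have htr : (M b * ρ * (M b)ᴴ).trace = (outcomeProb M ρ b : ℂ) := by
    rw [outcomeProb_eq]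
    refine Complex.ext (by simp) ?_
    simpa using (Complex.le_def.1 hpos.trace_nonneg).2.symm
  rw [postState, Matrix.trace_smul, htr, Complex.real_smul, ← Complex.ofReal_mul,
    inv_mul_cancel₀ hb, Complex.ofReal_one]

variable {d : Type*} [Fintype d] [DecidableEq d]

theorem traceLog_of_kernelLE {ρ σ : Op d} (h : KernelLE ρ σ) :
    traceLog ρ σ = (((ρ * cfc Real.log σ).trace.re : ℝ) : EReal) := by
  rw [traceLog, if_neg]
  push Not
  exact h

theorem traceLog_of_not_kernelLE {ρ σ : Op d} (h : ¬ KernelLE ρ σ) : traceLog ρ σ = ⊥ := by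
  rw [traceLog, if_pos]
  unfold KernelLE at h
  push Not at h
  exact h

/-- The entropy decrease in one step is at most the excess term of that step. -/
theorem entropy_sub_le_traceLog_sub {E : SuperOp d} (hE : IsCPTP E) {ρ σ : Op d}
    (hρ : ρ.PosSemidef) (hσ : σ.PosSemidef) (hfix : E σ = σ)
    (hdef : ¬ (traceLog (E ρ) σ = ⊥ ∧ traceLog ρ σ = ⊥)) :
    ((vonNeumannEntropy ρ - vonNeumannEntropy (E ρ) : ℝ) : EReal) ≤
      traceLog (E ρ) σ - traceLog ρ σ := by
  by_cases h : KernelLE ρ σ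
  · have h' := kernelLE_map hE hρ hσ h
    have hdp := trace_log_data_processing hE hρ hσ h
    rw [hfix] at h' hdp
    rw [traceLog_of_kernelLE h, traceLog_of_kernelLE h', ← EReal.coe_sub]
    exact_mod_cast hdp
  · -- Here `tr[ρ ln σ] = -∞`, and the difference is `+∞` because the other trace is finite.
    have h' : KernelLE (E ρ) σ := by
      by_contra h'
      exact hdef ⟨traceLog_of_not_kernelLE h', traceLog_of_not_kernelLE h⟩
    rw [traceLog_of_not_kernelLE h, traceLog_of_kernelLE h', EReal.sub_bot (EReal.coe_ne_bot _)]
    exact le_top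

theorem isDensity_trajectory {E : ℕ → SuperOp d} {k l : ℕ} (hkl : k ≤ l)
    (hE : ∀ n, k + 1 ≤ n → n ≤ l → IsCPTP (E n)) {ρ : Op d} (hρ : IsDensity ρ) :
    IsDensity (trajectory E k ρ l) := by
  induction l, hkl using Nat.le_induction with
  | base => rwa [trajectory_self]
  | succ l hkl ih =>
    rw [trajectory_succ E hkl]
    exact isDensity_map (hE (l + 1) (by omega) le_rfl)
      (ih fun n h1 h2 => hE n h1 (h2.trans l.le_succ))

/-- The entropy decrease along a trajectory is at most the excess term. In particular the latter is
not `-∞`. -/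
theorem entropy_sub_le_excess {E : ℕ → SuperOp d} {ss : ℕ → Op d} {k l : ℕ} (hkl : k ≤ l)
    (hE : ∀ n, k + 1 ≤ n → n ≤ l → IsCPTP (E n))
    (hss : ∀ n, k + 1 ≤ n → n ≤ l → IsUniqueSteadyState (E n) (ss n))
    {ρ : Op d} (hρ : IsDensity ρ) (hdef : ExcessDefined E ss k l ρ) :
    ((vonNeumannEntropy ρ - vonNeumannEntropy (trajectory E k ρ l) : ℝ) : EReal) ≤
      excess E ss k l ρ := by
  induction l, hkl using Nat.le_induction with
  | base => simp [excess, trajectory_self]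
  | succ l hkl ih =>
    have ih' := ih (fun n h1 h2 => hE n h1 (h2.trans l.le_succ))
      (fun n h1 h2 => hss n h1 (h2.trans l.le_succ))
      (fun n hn => hdef n (Finset.Ico_subset_Ico_right l.le_succ hn))
    have hd := isDensity_trajectory hkl (fun n h1 h2 => hE n h1 (h2.trans l.le_succ)) hρ
    have hs := (hss (l + 1) (by omega) le_rfl).1
    have hdl := hdef l (by simp [hkl])
    rw [trajectory_succ E hkl] at hdl
    have hstep := entropy_sub_le_traceLog_sub (hE (l + 1) (by omega) le_rfl) hd.1 hs.1.1 hs.2 hdl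
    have hadd := add_le_add ih' hstep
    rw [excess, Finset.sum_Ico_succ_top hkl, trajectory_succ E hkl]
    rw [← EReal.coe_add, sub_add_sub_cancel] at hadd
    exact hadd

end HatanoSasa

end QFeedback

open QFeedback in
theorem theorem6p2 {d B : Type*} [Fintype d] [DecidableEq d] [Fintype B]
    (m N : ℕ) (hmN : m ≤ N)
    (ρi : Op d) (hρi : IsDensity ρi)
    (E : ℕ → SuperOp d) (ss : ℕ → Op d)
    (hE : ∀ n, 1 ≤ n → n ≤ m → IsCPTP (E n))
    (hss : ∀ n, 1 ≤ n → n ≤ m → IsUniqueSteadyState (E n) (ss n))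
    (M : B → Op d) (hM : ∑ b, (M b)ᴴ * M b = 1)
    (F : B → ℕ → SuperOp d) (ssF : B → ℕ → Op d)
    (hF : ∀ b n, m + 1 ≤ n → n ≤ N → IsCPTP (F b n))
    (hssF : ∀ b n, m + 1 ≤ n → n ≤ N → IsUniqueSteadyState (F b n) (ssF b n))
    (hpre : ExcessDefined E ss 0 m ρi)
    (hpost : ∀ b, outcomeProb M (trajectory E 0 ρi m) b ≠ 0 →
      ExcessDefined (F b) (ssF b) m N (postState M (trajectory E 0 ρi m) b)) :
    (((∑ b, outcomeProb M (trajectory E 0 ρi m) b *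
          vonNeumannEntropy
            (trajectory (F b) m (postState M (trajectory E 0 ρi m) b) N)) -
        vonNeumannEntropy ρi : ℝ) : EReal) ≥
      - totalExcess m N ρi E ss M F ssF -
        ((qcMutualInfo M (trajectory E 0 ρi m) : ℝ) : EReal) := by
  have hd := isDensity_trajectory (Nat.zero_le m) (by simpa using hE) hρi
  have h1 := entropy_sub_le_excess (Nat.zero_le m) (by simpa using hE) (by simpa using hss) hρi hpre
  generalize hρm : trajectory E 0 ρi m = ρm at *
  have h2 : ∀ b, ((outcomeProb M ρm b * (vonNeumannEntropy (postState M ρm b) -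
        vonNeumannEntropy (trajectory (F b) m (postState M ρm b) N)) : ℝ) : EReal) ≤
      ((outcomeProb M ρm b : ℝ) : EReal) * excess (F b) (ssF b) m N (postState M ρm b) := by
    intro b
    -- For `p(b) = 0` the excess term may be anything, even `-∞`; `0 * x = 0` in `EReal`.
    by_cases hb : outcomeProb M ρm b = 0
    · simp [hb]
    · rw [EReal.coe_mul]
      exact mul_le_mul_of_nonneg_left (entropy_sub_le_excess hmN (hF b) (hssF b)
        (isDensity_postState hd.1 hb) (hpost b hb))
        (EReal.coe_nonneg.2 (outcomeProb_nonneg M hd.1 b))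
  have h3 := add_le_add h1 (Finset.sum_le_sum fun b (_ : b ∈ Finset.univ) => h2 b)
  have hT : totalExcess m N ρi E ss M F ssF = excess E ss 0 m ρi +
      ∑ b, ((outcomeProb M ρm b : ℝ) : EReal) *
        excess (F b) (ssF b) m N (postState M ρm b) := by
    rw [totalExcess, hρm]
  rw [← hT] at h3
  refine (EReal.sub_le_sub (EReal.neg_le_neg_iff.2 h3) le_rfl).trans (le_of_eq ?_)
  have hsum : ∀ f : B → ℝ, ∑ b, ((f b : ℝ) : EReal) = ((∑ b, f b : ℝ) : EReal) := fun f =>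
    (map_sum (⟨⟨Real.toEReal, EReal.coe_zero⟩, EReal.coe_add⟩ : ℝ →+ EReal) f _).symm
  rw [hsum, ← EReal.coe_add, ← EReal.coe_neg, ← EReal.coe_sub, qcMutualInfo]
  simp only [mul_sub, Finset.sum_sub_distrib]
  congr 1
  ring
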